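/- Let $n\in\{1,2,3\}$ and let $U\subseteq\mathbb{R}^n$ be open. Consider first-order differential operators (vector fields) $Q=\sum_{i=1}^n a_i(x)\,\partial_{x_i}$ on $U$ with smooth real coefficients $a_i$ and with the commutator $[P,Q]=PQ-QP$. A realization of the Virasoro algebra on $U$ consists of such vector fields $L_m$ ($m\in\mathbb{Z}$) and $C$ with $$[L_m,L_k]=(m-k)L_{m+k}+\tfrac1{12}m(m^2-1)\,\delta_{m,-k}\,C,\qquad [L_m,C]=0\qquad (m,k\in\mathbb{Z}),$$ where $\delta$ is the Kronecker delta. There is no such realization in which $C$ is not identically zero: in every realization of the Virasoro algebra on $U$, $C$ vanishes at every point of $U$. Consequently every such realization is a realization of the Witt algebra, that is, $[L_m,L_k]=(m-k)L_{m+k}$ on $U$ for all $m,k\in\mathbb{Z}$. -/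

import Mathlib

open scoped ContDiff

/-- A family of vector fields `L m` (`m : ℤ`) and a vector field `C` form a realization of the
Virasoro algebra on `U ⊆ ℝⁿ`: they are smooth on `U` and satisfy there
`[L m, L k] = (m - k) L (m + k) + (1/12) m (m ^ 2 - 1) δ_{m,-k} C` and `[L m, C] = 0`.
The operator `∑ i, a i ∂ᵢ` is encoded by its coefficient function `a : ℝⁿ → ℝⁿ`; then
`VectorField.lieBracket ℝ P Q` encodes the commutator `P Q - Q P` of differential operators. -/
structure IsVirasoroRealization {n : ℕ} (U : Set (EuclideanSpace ℝ (Fin n)))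
    (L : ℤ → EuclideanSpace ℝ (Fin n) → EuclideanSpace ℝ (Fin n))
    (C : EuclideanSpace ℝ (Fin n) → EuclideanSpace ℝ (Fin n)) : Prop where
  smooth_L : ∀ m : ℤ, ContDiffOn ℝ ∞ (L m) U
  smooth_C : ContDiffOn ℝ ∞ C U
  bracket_L_L : ∀ m k : ℤ, ∀ x ∈ U,
    VectorField.lieBracket ℝ (L m) (L k) x =
      ((m : ℝ) - (k : ℝ)) • L (m + k) x +
        (if m = -k then (1 / 12 : ℝ) * (m : ℝ) * ((m : ℝ) ^ 2 - 1) else 0) • C x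
  bracket_L_C : ∀ m : ℤ, ∀ x ∈ U, VectorField.lieBracket ℝ (L m) C x = 0

/-- A family of vector fields `L m` (`m : ℤ`) forms a realization of the Witt algebra on
`U ⊆ ℝⁿ`: they are smooth on `U` and satisfy there `[L m, L k] = (m - k) L (m + k)`. -/
structure IsWittRealization {n : ℕ} (U : Set (EuclideanSpace ℝ (Fin n)))
    (L : ℤ → EuclideanSpace ℝ (Fin n) → EuclideanSpace ℝ (Fin n)) : Prop where
  smooth_L : ∀ m : ℤ, ContDiffOn ℝ ∞ (L m) U
  bracket_L_L : ∀ m k : ℤ, ∀ x ∈ U,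
    VectorField.lieBracket ℝ (L m) (L k) x = ((m : ℝ) - (k : ℝ)) • L (m + k) x

/-! Two fields vanishing at `x` have a bracket vanishing at `x`. By dimension count, one finite even
family `a ≠ 0` makes `A_k = ∑ a_e L_{e+k}` vanish at `x` for `k = ±1, ±2`. In `[A_k, A_{-k}]` the
weight is `e - f + 2k`; its antisymmetric part cancels, leaving `2k T + c_k C = 0` at `x` with `T`
independent of `k`. Eliminating `T` between `k = 1, 2` leaves a positive multiple of `C x`, because
the cocycle is cubic in `k`. -/

/-- If two families of combinations of the fields `L m`, taken with the same coefficients and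
shifted by `k` and by `-k`, vanish at `x`, then so does the double sum of their brackets. -/
theorem sum_sum_lieBracket_eq_zero {E : Type*} [NormedAddCommGroup E] [NormedSpace ℝ E]
    (L : ℤ → E → E) (x : E) (s : Finset ℤ) (a : ℤ → ℝ) (k : ℤ)
    (hpos : ∑ e ∈ s, a e • L (e + k) x = 0) (hneg : ∑ e ∈ s, a e • L (e - k) x = 0) :
    ∑ e ∈ s, ∑ f ∈ s, (a e * a f) • VectorField.lieBracket ℝ (L (e + k)) (L (f - k)) x = 0 := by
  -- For fixed `f` the derivative at `x` is linear, so the sum over `e` moves into its argument.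
  have h1 : ∑ e ∈ s, ∑ f ∈ s, (a e * a f) • fderiv ℝ (L (f - k)) x (L (e + k) x) = 0 := by
    rw [Finset.sum_comm]
    refine Finset.sum_eq_zero fun f _ => ?_
    have := congrArg (fun v => a f • fderiv ℝ (L (f - k)) x v) hpos
    simpa [Finset.smul_sum, smul_smul, mul_comm] using this
  have h2 : ∑ e ∈ s, ∑ f ∈ s, (a e * a f) • fderiv ℝ (L (e + k)) x (L (f - k) x) = 0 := by
    refine Finset.sum_eq_zero fun e _ => ?_
    have := congrArg (fun v => a e • fderiv ℝ (L (e + k)) x v) hneg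
    simpa [Finset.smul_sum, smul_smul] using this
  simp only [VectorField.lieBracket, smul_sub, Finset.sum_sub_distrib, h1, h2, sub_zero]

/-- An antisymmetric weight contributes nothing to a double sum of symmetric terms. -/
theorem sum_sum_sub_smul_eq_zero {E : Type*} [AddCommGroup E] [Module ℝ E]
    (v : ℤ → E) (s : Finset ℤ) (a : ℤ → ℝ) :
    ∑ e ∈ s, ∑ f ∈ s, (a e * a f * ((e : ℝ) - f)) • v (e + f) = 0 := by
  have h : ∑ e ∈ s, ∑ f ∈ s, (a e * a f * ((e : ℝ) - f)) • v (e + f) =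
      -∑ e ∈ s, ∑ f ∈ s, (a e * a f * ((e : ℝ) - f)) • v (e + f) := by
    conv_lhs => rw [Finset.sum_comm]
    simp only [← Finset.sum_neg_distrib, ← neg_smul]
    refine Finset.sum_congr rfl fun e _ => Finset.sum_congr rfl fun f _ => ?_
    rw [add_comm f e]
    congr 1
    ring
  have h2 : (2 : ℝ) • ∑ e ∈ s, ∑ f ∈ s, (a e * a f * ((e : ℝ) - f)) • v (e + f) = 0 := by
    rw [two_smul]
    exact eq_neg_iff_add_eq_zero.mp h
  exact (smul_eq_zero.mp h2).resolve_left two_ne_zero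

/-- An odd function sums to zero over a symmetric finite set of integers. -/
theorem sum_eq_zero_of_odd (s : Finset ℤ) (hs : ∀ e ∈ s, -e ∈ s) (g : ℤ → ℝ)
    (hg : ∀ e, g (-e) = -g e) : ∑ e ∈ s, g e = 0 := by
  have h : ∑ e ∈ s, g e = ∑ e ∈ s, g (-e) :=
    Finset.sum_nbij' (fun e => -e) (fun e => -e) hs hs (by simp) (by simp) (by simp)
  simp only [hg, Finset.sum_neg_distrib] at h
  linarith

/-- The relation at `x` produced by the bracket of the combinations of the `L m` with even
coefficients `a`, shifted by `k` and `-k`. -/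
theorem IsVirasoroRealization.smul_sum_add_smul_eq_zero {n : ℕ}
    {U : Set (EuclideanSpace ℝ (Fin n))}
    {L : ℤ → EuclideanSpace ℝ (Fin n) → EuclideanSpace ℝ (Fin n)}
    {C : EuclideanSpace ℝ (Fin n) → EuclideanSpace ℝ (Fin n)}
    (h : IsVirasoroRealization U L C) {x : EuclideanSpace ℝ (Fin n)} (hx : x ∈ U)
    (s : Finset ℤ) (hs : ∀ e ∈ s, -e ∈ s) (a : ℤ → ℝ) (ha : ∀ e, a (-e) = a e) (k : ℤ)
    (hpos : ∑ e ∈ s, a e • L (e + k) x = 0) (hneg : ∑ e ∈ s, a e • L (e - k) x = 0) :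
    (2 * k : ℝ) • ∑ e ∈ s, ∑ f ∈ s, (a e * a f) • L (e + f) x +
      (∑ e ∈ s, a e ^ 2 * (3 * k * (e : ℝ) ^ 2 + k ^ 3 - k) / 12) • C x = 0 := by
  have key := sum_sum_lieBracket_eq_zero L x s a k hpos hneg
  -- Only `f = -e` survives, with `a e * a (-e) = a e ^ 2`; the part of the cocycle odd in `e` sums
  -- to zero.
  have hcentral : ∑ e ∈ s, ∑ f ∈ s, (if f = -e then
        a e * a f * ((1 / 12 : ℝ) * ((e + k : ℤ) : ℝ) * (((e + k : ℤ) : ℝ) ^ 2 - 1)) else 0) =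
      ∑ e ∈ s, a e ^ 2 * (3 * k * (e : ℝ) ^ 2 + k ^ 3 - k) / 12 := by
    have hodd := sum_eq_zero_of_odd s hs
      (fun e => a e ^ 2 * ((e : ℝ) ^ 3 + 3 * k ^ 2 * e - e) / 12)
      (fun e => by simp only [ha]; push_cast; ring)
    refine Eq.trans ?_ ((congrArg (· + _) hodd).trans (zero_add _))
    rw [← Finset.sum_add_distrib]
    refine Finset.sum_congr rfl fun e he => ?_
    rw [Finset.sum_ite_eq' s (-e), if_pos (hs e he), ha]
    push_cast
    ring
  have hterm : ∀ e f : ℤ,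
      (a e * a f) • VectorField.lieBracket ℝ (L (e + k)) (L (f - k)) x =
        (a e * a f * ((e : ℝ) - f)) • L (e + f) x +
        ((2 * k : ℝ) • (a e * a f) • L (e + f) x +
        (if f = -e then
          a e * a f * ((1 / 12 : ℝ) * ((e + k : ℤ) : ℝ) * (((e + k : ℤ) : ℝ) ^ 2 - 1)) else 0) •
            C x) := by
    intro e f
    rw [h.bracket_L_L _ _ x hx, show e + k + (f - k) = e + f by ring]
    have hiff : e + k = -(f - k) ↔ f = -e := by constructor <;> intro h <;> linarith
    simp only [hiff]
    split_ifs <;> push_cast <;> module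
  simp only [hterm, Finset.sum_add_distrib, sum_sum_sub_smul_eq_zero (fun m => L m x) s a,
    zero_add, ← Finset.sum_smul, ← Finset.smul_sum, hcentral] at key
  exact key

/-- Even coefficients, not all zero, supported on an interval, such that the four combinations of
vectors shifted by `1, -1, 2, -2` vanish. -/
theorem exists_even_coeff_sum_shift_eq_zero {E : Type*} [AddCommGroup E] [Module ℝ E]
    [FiniteDimensional ℝ E] (v : ℤ → E) :
    ∃ (s : Finset ℤ) (a : ℤ → ℝ), (∀ e ∈ s, -e ∈ s) ∧ (∀ e, a (-e) = a e) ∧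
      (∃ e ∈ s, a e ≠ 0) ∧ ∀ k ∈ ({1, -1, 2, -2} : Finset ℤ), ∑ e ∈ s, a e • v (e + k) = 0 := by
  -- Evenness leaves `N + 1` unknowns `c_|e|`, one more than the scalar equations from four shifts.
  obtain ⟨N, hN⟩ : ∃ N, N = 4 * Module.finrank ℝ E := ⟨_, rfl⟩
  let T : Finset ℤ := {1, -1, 2, -2}
  let s : Finset ℤ := Finset.Icc (-(N : ℤ)) N
  let Φ : (Fin (N + 1) → ℝ) →ₗ[ℝ] (T → E) := LinearMap.pi fun k => ∑ e ∈ s,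
    (LinearMap.proj (Fin.ofNat (N + 1) e.natAbs) : (Fin (N + 1) → ℝ) →ₗ[ℝ] ℝ).smulRight
      (v (e + k))
  have hker : LinearMap.ker Φ ≠ ⊥ := by
    apply LinearMap.ker_ne_bot_of_finrank_lt
    have hT : Fintype.card T = 4 := rfl
    rw [Module.finrank_pi_fintype, Finset.sum_const, Finset.card_univ, hT, Module.finrank_fin_fun]
    simp [hN]
  obtain ⟨c, hc, hc0⟩ := (Submodule.ne_bot_iff _).mp hker
  obtain ⟨i, hi⟩ := Function.ne_iff.mp hc0
  refine ⟨s, fun e => c (Fin.ofNat (N + 1) e.natAbs), ?_, by simp, ⟨(i : ℕ), ?_, ?_⟩, ?_⟩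
  · intro e he
    simp only [s, Finset.mem_Icc] at he ⊢
    omega
  · simp only [s, Finset.mem_Icc]
    omega
  · simpa using hi
  · intro k hk
    simpa [Φ] using congrFun (LinearMap.mem_ker.mp hc) ⟨k, hk⟩

/-- In every realization of the Virasoro algebra by vector fields in finite dimension, the central
element vanishes. -/
theorem IsVirasoroRealization.central_eq_zero {n : ℕ} {U : Set (EuclideanSpace ℝ (Fin n))}
    {L : ℤ → EuclideanSpace ℝ (Fin n) → EuclideanSpace ℝ (Fin n)}
    {C : EuclideanSpace ℝ (Fin n) → EuclideanSpace ℝ (Fin n)}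
    (h : IsVirasoroRealization U L C) {x : EuclideanSpace ℝ (Fin n)} (hx : x ∈ U) : C x = 0 := by
  obtain ⟨s, a, hs, ha, ⟨e₀, he₀, hne⟩, hv⟩ :=
    exists_even_coeff_sum_shift_eq_zero fun m => L m x
  have h1 := h.smul_sum_add_smul_eq_zero hx s hs a ha 1 (hv 1 (by simp)) (hv (-1) (by simp))
  have h2 := h.smul_sum_add_smul_eq_zero hx s hs a ha 2 (hv 2 (by simp)) (hv (-2) (by simp))
  set T := ∑ e ∈ s, ∑ f ∈ s, (a e * a f) • L (e + f) x
  -- Terms linear in `k` cancel; `k ^ 3` leaves `(8 - 2) / 12 = 1 / 2`.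
  have hsum : (∑ e ∈ s, a e ^ 2 * (3 * (2 : ℤ) * (e : ℝ) ^ 2 + (2 : ℤ) ^ 3 - (2 : ℤ)) / 12) -
      2 * ∑ e ∈ s, a e ^ 2 * (3 * (1 : ℤ) * (e : ℝ) ^ 2 + (1 : ℤ) ^ 3 - (1 : ℤ)) / 12 =
      (1 / 2) * ∑ e ∈ s, a e ^ 2 := by
    rw [Finset.mul_sum, Finset.mul_sum, ← Finset.sum_sub_distrib]
    refine Finset.sum_congr rfl fun e _ => ?_
    push_cast
    ring
  have hpos : 0 < ∑ e ∈ s, a e ^ 2 :=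
    Finset.sum_pos' (fun e _ => sq_nonneg _) ⟨e₀, he₀, by positivity⟩
  have hC : ((1 / 2) * ∑ e ∈ s, a e ^ 2) • C x = 0 := by
    rw [← hsum]
    generalize (∑ e ∈ s, a e ^ 2 * (3 * (2 : ℤ) * (e : ℝ) ^ 2 + (2 : ℤ) ^ 3 - (2 : ℤ)) / 12) = p
      at h2 ⊢
    generalize (∑ e ∈ s, a e ^ 2 * (3 * (1 : ℤ) * (e : ℝ) ^ 2 + (1 : ℤ) ^ 3 - (1 : ℤ)) / 12) = q
      at h1 ⊢
    push_cast at h1 h2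
    calc (p - 2 * q) • C x
      _ = ((2 * 2 : ℝ) • T + p • C x) - (2 : ℝ) • ((2 * 1 : ℝ) • T + q • C x) := by module
      _ = 0 := by rw [h1, h2, smul_zero, sub_zero]
  exact (smul_eq_zero.mp hC).resolve_left (by positivity)

theorem theorem4 (n : ℕ) (hn1 : 1 ≤ n) (hn3 : n ≤ 3)
    (U : Set (EuclideanSpace ℝ (Fin n))) (hU : IsOpen U)
    (L : ℤ → EuclideanSpace ℝ (Fin n) → EuclideanSpace ℝ (Fin n))
    (C : EuclideanSpace ℝ (Fin n) → EuclideanSpace ℝ (Fin n))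
    (h : IsVirasoroRealization U L C) :
    (∀ x ∈ U, C x = 0) ∧ IsWittRealization U L :=
  ⟨fun _ hx => h.central_eq_zero hx, h.smooth_L, fun m k x hx => by
    rw [h.bracket_L_L m k x hx, h.central_eq_zero hx, smul_zero, add_zero]⟩
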